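/- Let $q$ be an indeterminate. For $n\geqslant 0$ put $[n]=1+q+\cdots+q^{n-1}$ and $[n]!=[n][n-1]\cdots[1]$ (so $[0]!=1$). For nonnegative integers $n,k$ let ${n\brack k}=\frac{(1-q^n)(1-q^{n-1})\cdots(1-q^{n-k+1})}{(1-q)(1-q^2)\cdots(1-q^k)}$ if $k\leqslant n$, and ${n\brack k}=0$ if $k>n$. Let $a$ and $b$ be nonnegative integers and let $p$ be a prime with $p>\max\{a,b\}$. Then $$\frac{[a+b+1]!}{[a]!\,[b]!}\sum_{h=0}^{p-1}q^h{h\brack a}{h\brack b}\equiv(-1)^{a-b}q^{ab-\binom a2-\binom b2}\,[p]\pmod{[p]^2},$$ as a congruence in the ring $\mathbb Z[q,q^{-1}]$ of Laurent polynomials with integer coefficients (both sides lie in this ring). Consequently, in the integers, $$\frac{(a+b+1)!}{a!\,b!}\sum_{h=0}^{p-1}\binom ha\binom hb\equiv(-1)^{a-b}\,p\pmod{p^2}.$$ -/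

import Mathlib

noncomputable section

namespace QAnalog

/-- The indeterminate `q`, in the field of rational functions `ℚ(q)`. -/
def q : RatFunc ℚ := RatFunc.X

/-- The `q`-integer `[n] = 1 + q + ⋯ + q ^ (n - 1)`. -/
def qInt (n : ℕ) : RatFunc ℚ := ∑ i ∈ Finset.range n, q ^ i

/-- The `q`-factorial `[n]! = [n] [n - 1] ⋯ [1]`. -/
def qFactorial (n : ℕ) : RatFunc ℚ := ∏ i ∈ Finset.range n, qInt (i + 1)

/-- The `q`-binomial coefficient
`(1 - q ^ n) ⋯ (1 - q ^ (n - k + 1)) / ((1 - q) ⋯ (1 - q ^ k))` for `k ≤ n`, and `0` for `n < k`. -/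
def qBinomial (n k : ℕ) : RatFunc ℚ :=
  if k ≤ n then
    (∏ i ∈ Finset.range k, (1 - q ^ (n - i))) / ∏ i ∈ Finset.range k, (1 - q ^ (i + 1))
  else 0

/-- The ring `ℤ[q, q⁻¹]` of Laurent polynomials with integer coefficients, inside `ℚ(q)`. -/
def laurentRing : Subalgebra ℤ (RatFunc ℚ) := Algebra.adjoin ℤ {q, q⁻¹}

/-- `x ≡ y (mod m)` in the ring `ℤ[q, q⁻¹]`: both `x` and `y` lie in this ring, and their
difference is a multiple of `m` in it. -/
def LaurentModEq (m x y : RatFunc ℚ) : Prop :=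
  x ∈ laurentRing ∧ y ∈ laurentRing ∧ ∃ f ∈ laurentRing, x - y = m * f

end QAnalog

end

/-! Write $S(a,b)$ for the sum over $h<p$. Summation by parts expresses $S(a,b+1)$ through $S(a,b)$,
$S(a+1,b)$ and a boundary term that, after multiplication by $[a+b+2]!$, is divisible by $[p]^2$. So
the congruence follows by induction on $b$ from $S(a,0)=q^a{p\brack a+1}$. With denominators cleared
by $[a]!\,[b]!$, this works in any commutative ring with $q$ a unit and any positive $p$
(`sq_ringInt_dvd`). Primality serves only to cancel $[a]!\,[b]!$, which is coprime to $[p]$. The two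
claims are the cases $\mathbb Z[q,q^{-1}]$ and $q=1$ in $\mathbb Z$. -/

namespace QAnalog

/-! ### $q$-analogues over a commutative ring. -/

section General

variable {R : Type*} [CommRing R]

/-- The `q`-integer `[n]` at an element of a commutative ring. -/
def ringInt (q : R) (n : ℕ) : R := ∑ i ∈ Finset.range n, q ^ i

/-- The `q`-factorial `[n]!` at an element of a commutative ring. -/
def ringFactorial (q : R) (n : ℕ) : R := ∏ i ∈ Finset.range n, ringInt q (i + 1)

/-- The `q`-binomial coefficient at an element of a commutative ring, by the `q`-Pascal rule. -/
def ringBinomial (q : R) : ℕ → ℕ → R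
  | _, 0 => 1
  | 0, _ + 1 => 0
  | n + 1, k + 1 => ringBinomial q n k + q ^ (k + 1) * ringBinomial q n (k + 1)

@[simp] lemma ringBinomial_zero_right (q : R) (n : ℕ) : ringBinomial q n 0 = 1 := by
  cases n <;> rfl

@[simp] lemma ringBinomial_zero_succ (q : R) (k : ℕ) : ringBinomial q 0 (k + 1) = 0 := rfl

lemma ringBinomial_succ_succ (q : R) (n k : ℕ) :
    ringBinomial q (n + 1) (k + 1) =
      ringBinomial q n k + q ^ (k + 1) * ringBinomial q n (k + 1) := rfl

lemma ringBinomial_eq_zero (q : R) {n k : ℕ} (h : n < k) : ringBinomial q n k = 0 := by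
  induction n generalizing k with
  | zero => obtain ⟨k, rfl⟩ := Nat.exists_eq_succ_of_ne_zero h.ne'; rfl
  | succ n ih =>
    obtain ⟨k, rfl⟩ := Nat.exists_eq_succ_of_ne_zero (Nat.ne_zero_of_lt h)
    rw [Nat.succ_eq_add_one, ringBinomial_succ_succ, ih (by omega), ih (by omega)]
    ring

@[simp] lemma ringInt_zero (q : R) : ringInt q 0 = 0 := by simp [ringInt]

lemma ringInt_succ (q : R) (n : ℕ) : ringInt q (n + 1) = ringInt q n + q ^ n :=
  Finset.sum_range_succ _ _

lemma ringInt_add (q : R) (m n : ℕ) :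
    ringInt q (m + n) = ringInt q m + q ^ m * ringInt q n := by
  simp [ringInt, Finset.sum_range_add, pow_add, Finset.mul_sum]

lemma ringInt_succ' (q : R) (n : ℕ) : ringInt q (n + 1) = 1 + q * ringInt q n := by
  rw [add_comm, ringInt_add]
  simp [ringInt]

lemma ringInt_mul (q : R) (m n : ℕ) :
    ringInt q (m * n) = ringInt q m * ringInt (q ^ m) n := by
  induction n with
  | zero => simp
  | succ n ih => rw [Nat.mul_succ, ringInt_add, ih, ringInt_succ, pow_mul]; ring

lemma one_sub_mul_ringInt (q : R) (n : ℕ) : (1 - q) * ringInt q n = 1 - q ^ n :=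
  mul_neg_geom_sum q n

@[simp] lemma ringFactorial_zero (q : R) : ringFactorial q 0 = 1 := rfl

lemma ringFactorial_succ (q : R) (n : ℕ) :
    ringFactorial q (n + 1) = ringFactorial q n * ringInt q (n + 1) :=
  Finset.prod_range_succ _ _

/-- The second `q`-Pascal rule. -/
lemma pow_mul_ringBinomial_succ_succ (q : R) (n k : ℕ) :
    q ^ k * ringBinomial q (n + 1) (k + 1) =
      q ^ n * ringBinomial q n k + q ^ k * ringBinomial q n (k + 1) := by
  induction n generalizing k with
  | zero => cases k <;> simp [ringBinomial_succ_succ]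
  | succ n ih =>
    rw [ringBinomial_succ_succ q (n + 1) k]
    cases k with
    | zero =>
      have h := ih 0
      simp only [ringBinomial_succ_succ, ringBinomial_zero_right] at h ⊢
      linear_combination q * h
    | succ k =>
      have h₀ := ih k
      have h₁ := ih (k + 1)
      simp only [ringBinomial_succ_succ] at h₀ h₁ ⊢
      linear_combination q * h₀ + q ^ (k + 2) * h₁

lemma ringInt_mul_ringBinomial_succ_succ (q : R) (n k : ℕ) :
    ringInt q (k + 1) * ringBinomial q (n + 1) (k + 1) =
      ringInt q (n + 1) * ringBinomial q n k := by
  induction n generalizing k with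
  | zero => cases k <;> simp [ringBinomial_succ_succ]
  | succ n ih =>
    rw [ringBinomial_succ_succ q (n + 1) k, mul_add, mul_left_comm, ih]
    cases k with
    | zero =>
      rw [ringInt_succ' q (n + 1)]
      simp [ringInt]
    | succ k =>
      have h := ih k
      rw [ringInt_succ' q (k + 1), ringInt_succ' q (n + 1)]
      have h' := ringBinomial_succ_succ q n k
      linear_combination q * h - q * ringInt q (n + 1) * h'

/-- Valid for $k>n$ too: truncated subtraction then produces a factor $1-q^0=0$. -/
lemma prod_mul_ringBinomial (q : R) (n k : ℕ) :
    (∏ i ∈ Finset.range k, (1 - q ^ (i + 1))) * ringBinomial q n k =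
      ∏ i ∈ Finset.range k, (1 - q ^ (n - i)) := by
  induction k generalizing n with
  | zero => simp
  | succ k ih =>
    cases n with
    | zero => simp [Finset.prod_range_succ]
    | succ n =>
      have h := ringInt_mul_ringBinomial_succ_succ q n k
      have h₁ := one_sub_mul_ringInt q (k + 1)
      have h₂ := one_sub_mul_ringInt q (n + 1)
      rw [Finset.prod_range_succ, Finset.prod_range_succ']
      simp only [Nat.add_sub_add_right, Nat.sub_zero, ← ih, ← h₁, ← h₂]
      linear_combination (∏ i ∈ Finset.range k, (1 - q ^ (i + 1))) * (1 - q) * h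

lemma ringFactorial_add (q : R) (m k : ℕ) :
    ringFactorial q (m + k) = ringFactorial q m * ringFactorial q k * ringBinomial q (m + k) k := by
  induction k with
  | zero => simp
  | succ k ih =>
    rw [← add_assoc, ringFactorial_succ, ringFactorial_succ, ih]
    linear_combination -ringFactorial q m * ringFactorial q k *
      ringInt_mul_ringBinomial_succ_succ q (m + k) k

/-! ### The congruence with denominators cleared. -/

/-- The sum `∑ q ^ h [h, a] [h, b]` over `h < p`. -/
def binomialSum (q : R) (p a b : ℕ) : R :=
  ∑ h ∈ Finset.range p, q ^ h * ringBinomial q h a * ringBinomial q h b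

/-- The sum telescopes by the second $q$-Pascal rule. -/
lemma binomialSum_zero_right (q : R) (p a : ℕ) :
    binomialSum q p a 0 = q ^ a * ringBinomial q p (a + 1) := by
  induction p with
  | zero => simp [binomialSum]
  | succ p ih =>
    rw [binomialSum, Finset.sum_range_succ, ← binomialSum, ih,
      pow_mul_ringBinomial_succ_succ]
    simp [add_comm]

/-- Summation by parts. -/
lemma binomialSum_succ_right (q : R) (p a b : ℕ) :
    q ^ b * binomialSum q p a (b + 1) =
      q ^ (a + b) * (ringBinomial q p (a + 1) * ringBinomial q p (b + 1)) -
      q ^ a * (binomialSum q p a b + q ^ (a + 1) * binomialSum q p (a + 1) b) := by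
  induction p with
  | zero => simp [binomialSum]
  | succ p ih =>
    have h : ∀ c d, binomialSum q (p + 1) c d =
        binomialSum q p c d + q ^ p * ringBinomial q p c * ringBinomial q p d :=
      fun c d ↦ Finset.sum_range_succ _ _
    have ha := pow_mul_ringBinomial_succ_succ q p a
    have ha' := ringBinomial_succ_succ q p a
    have hb := pow_mul_ringBinomial_succ_succ q p b
    rw [h, h, h]
    linear_combination ih - q ^ a * ringBinomial q (p + 1) (a + 1) * hb
      - q ^ b * ringBinomial q p (b + 1) * ha - q ^ a * q ^ p * ringBinomial q p b * ha'

/-- Modulo $[n+1]$, absorption and Pascal give $[a+1]\bigl({n\brack a}+q^{a+1}{n\brack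
a+1}\bigr)\equiv0$. The factor $[a]!$ avoids dividing by $[a+1]$. -/
lemma ringInt_dvd_ringFactorial_mul_ringBinomial (q : R) (n a : ℕ) :
    ringInt q (n + 1) ∣ ringFactorial q a *
      (q ^ (a + 1).choose 2 * ringBinomial q n a - (-1) ^ a) := by
  induction a with
  | zero => simp
  | succ a ih =>
    obtain ⟨c, hc⟩ := ih
    have h := ringInt_mul_ringBinomial_succ_succ q n a
    rw [ringBinomial_succ_succ] at h
    refine ⟨q ^ (a + 1).choose 2 * ringFactorial q a * ringBinomial q n a
      - ringInt q (a + 1) * c, ?_⟩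
    have e : (a + 1 + 1).choose 2 = (a + 1).choose 2 + (a + 1) := by
      rw [Nat.choose_succ_succ' (a + 1) 1]; simp [add_comm]
    rw [ringFactorial_succ, e, pow_add q ((a + 1).choose 2)]
    linear_combination q ^ (a + 1).choose 2 * ringFactorial q a * h - ringInt q (a + 1) * hc

/-- The exponent `ab - binom(a, 2) - binom(b, 2)`. -/
def binomialExponent (a b : ℕ) : ℤ := (a : ℤ) * b - a.choose 2 - b.choose 2

theorem sq_ringInt_dvd (q : Rˣ) (n a b : ℕ) :
    ringInt (q : R) (n + 1) ^ 2 ∣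
      ringFactorial (q : R) (a + b + 1) * binomialSum (q : R) (n + 1) a b -
        (-1) ^ (a + b) * ringFactorial (q : R) a * ringFactorial (q : R) b *
          ((q ^ binomialExponent a b : Rˣ) : R) * ringInt (q : R) (n + 1) := by
  induction b generalizing a with
  | zero =>
    obtain ⟨c, hc⟩ := ringInt_dvd_ringFactorial_mul_ringBinomial (q : R) n a
    have h := ringInt_mul_ringBinomial_succ_succ (q : R) n a
    set e := ((q ^ binomialExponent a 0 : Rˣ) : R) with he
    have hq : e * (q : R) ^ (a + 1).choose 2 = (q : R) ^ a := by
      rw [he, ← Units.val_pow_eq_pow_val, ← Units.val_pow_eq_pow_val, ← Units.val_mul,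
        ← zpow_natCast, ← zpow_natCast, ← zpow_add]
      congr 2
      rw [Nat.choose_succ_succ' a 1]
      simp [binomialExponent]
    refine ⟨e * c, ?_⟩
    rw [binomialSum_zero_right, add_zero, ringFactorial_succ, ringFactorial_zero]
    linear_combination ringFactorial (q : R) a * (q : R) ^ a * h
      + e * ringInt (q : R) (n + 1) * hc
      - ringInt (q : R) (n + 1) * ringFactorial (q : R) a * ringBinomial (q : R) n a * hq
  | succ b ih =>
    obtain ⟨c, hc⟩ := ih a
    obtain ⟨d, hd⟩ := ih (a + 1)
    have hsum := binomialSum_succ_right (q : R) (n + 1) a b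
    have hfac := ringFactorial_add (q : R) (a + 1) (b + 1)
    have hA := ringInt_mul_ringBinomial_succ_succ (q : R) n a
    have hB := ringInt_mul_ringBinomial_succ_succ (q : R) n b
    -- $[a+b+2]-q^{b+1}[a+1]=[b+1]$ merges the two inductive main terms into the new one.
    have hint := ringInt_add (q : R) (b + 1) (a + 1)
    rw [show b + 1 + (a + 1) = a + b + 2 by ring] at hint
    rw [show a + 1 + (b + 1) = a + b + 2 by ring, ringFactorial_succ _ a,
      ringFactorial_succ _ b] at hfac
    rw [show a + 1 + b + 1 = a + b + 2 by ring] at hd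
    rw [show a + (b + 1) + 1 = a + b + 2 by ring]
    have hsucc : ringFactorial (q : R) (a + b + 2) =
      ringFactorial (q : R) (a + b + 1) * ringInt (q : R) (a + b + 2) := ringFactorial_succ _ _
    set e := ((q ^ binomialExponent a (b + 1) : Rˣ) : R) with he
    have e₁ : (q : R) ^ a * ((q ^ binomialExponent a b : Rˣ) : R) = q ^ b * e := by
      rw [he, ← Units.val_pow_eq_pow_val, ← Units.val_pow_eq_pow_val, ← Units.val_mul,
        ← Units.val_mul, ← zpow_natCast, ← zpow_natCast, ← zpow_add, ← zpow_add]
      congr 2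
      simp only [binomialExponent, Nat.choose_succ_succ' b 1]
      push_cast [Nat.choose_one_right]
      ring
    have e₂ : (q : R) ^ (2 * a + 1) * ((q ^ binomialExponent (a + 1) b : Rˣ) : R) =
        q ^ (2 * b + 1) * e := by
      rw [he, ← Units.val_pow_eq_pow_val, ← Units.val_pow_eq_pow_val, ← Units.val_mul,
        ← Units.val_mul, ← zpow_natCast, ← zpow_natCast, ← zpow_add, ← zpow_add]
      congr 2
      simp only [binomialExponent, Nat.choose_succ_succ' b 1, Nat.choose_succ_succ' a 1]
      push_cast [Nat.choose_one_right]
      ring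
    -- Summation by parts only controls $q^b S(a,b+1)$.
    have hu : IsUnit ((q : R) ^ b) := q.isUnit.pow b
    rw [← hu.dvd_mul_left]
    -- The first term is the boundary term: $[a+1]$ and $[b+1]$, split off from $[a+b+2]!$, each
    -- extract one $[n+1]$ by absorption.
    refine ⟨(q : R) ^ (a + b) * (ringFactorial (q : R) a * ringFactorial (q : R) b *
        ringBinomial (q : R) (a + b + 2) (b + 1) * ringBinomial (q : R) n a *
        ringBinomial (q : R) n b)
      - (q : R) ^ a * ringInt (q : R) (a + b + 2) * c - (q : R) ^ (2 * a + 1) * d, ?_⟩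
    rw [ringFactorial_succ _ a] at hd
    rw [ringFactorial_succ _ b]
    generalize ((q ^ binomialExponent a b : Rˣ) : R) = E₁ at *
    generalize ((q ^ binomialExponent (a + 1) b : Rˣ) : R) = E₂ at *
    linear_combination ringFactorial (q : R) (a + b + 2) * hsum
      + (q : R) ^ (a + b) * ringBinomial (q : R) (n + 1) (a + 1) *
        ringBinomial (q : R) (n + 1) (b + 1) * hfac
      + (q : R) ^ (a + b) * ringFactorial (q : R) a * ringFactorial (q : R) b *
        ringBinomial (q : R) (a + b + 2) (b + 1) *
        (ringInt (q : R) (b + 1) * ringBinomial (q : R) (n + 1) (b + 1) * hA +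
          ringInt (q : R) (n + 1) * ringBinomial (q : R) n a * hB)
      - (q : R) ^ a * ringInt (q : R) (a + b + 2) * hc
      - (q : R) ^ a * binomialSum (q : R) (n + 1) a b * hsucc
      - (q : R) ^ (2 * a + 1) * hd
      + (-1) ^ (a + b) * ringFactorial (q : R) a * ringFactorial (q : R) b *
        ringInt (q : R) (n + 1) *
        (ringInt (q : R) (a + 1) * e₂ - ringInt (q : R) (a + b + 2) * e₁ - q ^ b * e * hint)

/-! ### Cancelling the factorials. -/

lemma isCoprime_ringInt {i p : ℕ} (q : R) (hp : 1 < p) (h : i.Coprime p) :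
    IsCoprime (ringInt q p) (ringInt q i) := by
  -- Expanding $[iu]=[pv+1]$ yields the Bézout relation $[i]\,[u]_{q^i}=1+q\,[p]\,[v]_{q^p}$.
  obtain ⟨u, v, huv⟩ : ∃ u v : ℕ, i * u = p * v + 1 := by
    obtain ⟨m, -, hm⟩ := Nat.exists_mul_mod_eq_one_of_coprime h hp
    exact ⟨m, i * m / p, by rw [← hm, Nat.div_add_mod]⟩
  have h₁ := ringInt_mul q i u
  rw [huv, ringInt_succ', ringInt_mul] at h₁
  exact ⟨-(q * ringInt (q ^ p) v), ringInt (q ^ i) u, by linear_combination -h₁⟩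

lemma isCoprime_ringFactorial {a p : ℕ} (q : R) (hp : p.Prime) (ha : a < p) :
    IsCoprime (ringInt q p) (ringFactorial q a) :=
  IsCoprime.prod_right fun i hi ↦ isCoprime_ringInt q hp.one_lt
    (Nat.coprime_of_lt_prime i.succ_ne_zero (by have := Finset.mem_range.1 hi; omega) hp).symm

lemma ringFactorial_add_add_one (q : R) (a b : ℕ) :
    ringFactorial q (a + b + 1) = ringFactorial q a * ringFactorial q b *
      (ringBinomial q (a + b) b * ringInt q (a + b + 1)) := by
  rw [ringFactorial_succ, ringFactorial_add, mul_assoc]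

theorem sq_ringInt_dvd_of_prime (q : Rˣ) {p a b : ℕ} (hp : p.Prime) (ha : a < p) (hb : b < p) :
    ringInt (q : R) p ^ 2 ∣
      ringBinomial (q : R) (a + b) b * ringInt (q : R) (a + b + 1) * binomialSum (q : R) p a b -
        (-1) ^ (a + b) * ((q ^ binomialExponent a b : Rˣ) : R) * ringInt (q : R) p := by
  have hc : IsCoprime (ringInt (q : R) p ^ 2) (ringFactorial (q : R) a * ringFactorial (q : R) b) :=
    ((isCoprime_ringFactorial _ hp ha).mul_right (isCoprime_ringFactorial _ hp hb)).pow_left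
  refine hc.dvd_of_dvd_mul_left ?_
  obtain ⟨n, rfl⟩ := Nat.exists_eq_succ_of_ne_zero hp.ne_zero
  convert sq_ringInt_dvd q n a b using 1
  rw [ringFactorial_add_add_one]
  ring

section Map

variable {S : Type*} [CommRing S] (f : R →+* S)

lemma map_ringInt (q : R) (n : ℕ) : f (ringInt q n) = ringInt (f q) n := by
  simp [ringInt]

lemma map_ringBinomial (q : R) (n k : ℕ) : f (ringBinomial q n k) = ringBinomial (f q) n k := by
  induction n generalizing k with
  | zero => cases k <;> simp
  | succ n ih => cases k <;> simp [ringBinomial_succ_succ, ih]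

lemma map_binomialSum (q : R) (p a b : ℕ) :
    f (binomialSum q p a b) = binomialSum (f q) p a b := by
  simp [binomialSum, map_ringBinomial]

end Map

end General

/-! ### Specialization at $q=1$. -/

section One

@[simp] lemma ringInt_one (n : ℕ) : ringInt (1 : ℤ) n = n := by simp [ringInt]

lemma ringFactorial_one (n : ℕ) : ringFactorial (1 : ℤ) n = n.factorial := by
  induction n with
  | zero => simp
  | succ n ih => rw [ringFactorial_succ, ih, Nat.factorial_succ, ringInt_one]; push_cast; ring

lemma ringBinomial_one (n k : ℕ) : ringBinomial (1 : ℤ) n k = n.choose k := by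
  induction n generalizing k with
  | zero => cases k <;> simp
  | succ n ih => cases k <;> simp [ringBinomial_succ_succ, ih, Nat.choose_succ_succ']

end One

/-! ### Comparison with $\mathbb Q(q)$ and the Laurent ring. -/

section RationalFunctions

lemma q_ne_zero : q ≠ 0 := RatFunc.X_ne_zero

lemma q_pow_ne_one {n : ℕ} (hn : n ≠ 0) : q ^ n ≠ 1 := by
  intro h
  have h' : (Polynomial.X ^ n : Polynomial ℚ) = 1 := by
    apply RatFunc.algebraMap_injective ℚ
    simpa [q] using h
  have := congrArg Polynomial.natDegree h'
  simp at this
  exact hn this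

lemma qBinomial_eq (n k : ℕ) : qBinomial n k = ringBinomial q n k := by
  unfold qBinomial
  split_ifs with h
  · rw [div_eq_iff, mul_comm, prod_mul_ringBinomial]
    exact Finset.prod_ne_zero_iff.2 fun i _ ↦ sub_ne_zero.2 (q_pow_ne_one i.succ_ne_zero).symm
  · exact (ringBinomial_eq_zero q (not_le.1 h)).symm

lemma qInt_ne_zero {n : ℕ} (hn : n ≠ 0) : qInt n ≠ 0 := by
  intro h
  have h₁ := one_sub_mul_ringInt q n
  rw [show ringInt q n = 0 from h, mul_zero] at h₁
  exact q_pow_ne_one hn (sub_eq_zero.1 h₁.symm).symm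

lemma qFactorial_ne_zero (n : ℕ) : qFactorial n ≠ 0 :=
  Finset.prod_ne_zero_iff.2 fun i _ ↦ qInt_ne_zero i.succ_ne_zero

/-- The indeterminate as a unit of the Laurent polynomial ring. -/
noncomputable def laurentQ : laurentRingˣ where
  val := ⟨q, Algebra.subset_adjoin (by simp)⟩
  inv := ⟨q⁻¹, Algebra.subset_adjoin (by simp)⟩
  val_inv := Subtype.ext (mul_inv_cancel₀ q_ne_zero)
  inv_val := Subtype.ext (inv_mul_cancel₀ q_ne_zero)

lemma val_laurentQ_zpow (n : ℤ) :
    (((laurentQ ^ n : laurentRingˣ) : laurentRing) : RatFunc ℚ) = q ^ n := by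
  have h : Units.map (laurentRing.val : laurentRing →* RatFunc ℚ) laurentQ =
      Units.mk0 q q_ne_zero := Units.ext rfl
  have h' := congrArg (fun u : (RatFunc ℚ)ˣ ↦ ((u ^ n : (RatFunc ℚ)ˣ) : RatFunc ℚ)) h
  simpa [← map_zpow] using h'

end RationalFunctions

lemma neg_one_zpow_sub {G : Type*} [DivisionRing G] (a b : ℕ) :
    (-1 : G) ^ ((a : ℤ) - b) = (-1) ^ (a + b) := by
  rw [zpow_sub₀ (by simp), pow_add]
  rcases neg_one_pow_eq_or G b with h | h <;> simp [h, div_neg]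

lemma units_neg_one_zpow_sub (a b : ℕ) :
    (((-1 : ℤˣ) ^ ((a : ℤ) - b) : ℤˣ) : ℤ) = (-1) ^ (a + b) := by
  rw [zpow_sub, pow_add]
  rcases neg_one_pow_eq_or ℤˣ b with h | h <;> rcases neg_one_pow_eq_or ℤ b with h' | h' <;>
    simp_all [Units.ext_iff]

end QAnalog

open QAnalog

theorem theorem2 (a b p : ℕ) (hp : p.Prime) (hab : max a b < p) :
    QAnalog.LaurentModEq (QAnalog.qInt p ^ 2)
      (QAnalog.qFactorial (a + b + 1) / (QAnalog.qFactorial a * QAnalog.qFactorial b) *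
        ∑ h ∈ Finset.range p, QAnalog.q ^ h * QAnalog.qBinomial h a * QAnalog.qBinomial h b)
      ((-1) ^ ((a : ℤ) - (b : ℤ)) *
        QAnalog.q ^ ((a : ℤ) * (b : ℤ) - (a.choose 2 : ℤ) - (b.choose 2 : ℤ)) *
        QAnalog.qInt p) ∧
    a.factorial * b.factorial ∣ (a + b + 1).factorial ∧
    (((a + b + 1).factorial / (a.factorial * b.factorial) *
        ∑ h ∈ Finset.range p, h.choose a * h.choose b : ℕ) : ℤ) ≡
      (((-1 : ℤˣ) ^ ((a : ℤ) - (b : ℤ)) : ℤˣ) : ℤ) * (p : ℤ) [ZMOD (p : ℤ) ^ 2] := by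
  obtain ⟨ha, hb⟩ := max_lt_iff.1 hab
  have hfac : (a + b + 1).factorial =
      a.factorial * b.factorial * ((a + b).choose b * (a + b + 1)) := by
    have h := ringFactorial_add_add_one (1 : ℤ) a b
    simp only [ringFactorial_one, ringBinomial_one, ringInt_one] at h
    exact_mod_cast h
  refine ⟨?_, ⟨_, hfac⟩, ?_⟩
  -- Both sides are lifted to the Laurent ring, so membership and an integral cofactor come for
  -- free.
  · let φ : laurentRing →+* RatFunc ℚ := laurentRing.val.toRingHom
    have hφ : φ laurentQ = q := rfl
    set x : laurentRing := ringBinomial (laurentQ : laurentRing) (a + b) b *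
      ringInt (laurentQ : laurentRing) (a + b + 1) * binomialSum (laurentQ : laurentRing) p a b
      with hx
    set y : laurentRing := (-1) ^ (a + b) *
      ((laurentQ ^ binomialExponent a b : laurentRingˣ) : laurentRing) *
      ringInt (laurentQ : laurentRing) p with hy
    have hx' : QAnalog.qFactorial (a + b + 1) / (QAnalog.qFactorial a * QAnalog.qFactorial b) *
        ∑ h ∈ Finset.range p, QAnalog.q ^ h * QAnalog.qBinomial h a * QAnalog.qBinomial h b
          = φ x := by
      have h : qFactorial (a + b + 1) = qFactorial a * qFactorial b *
        (ringBinomial q (a + b) b * ringInt q (a + b + 1)) := ringFactorial_add_add_one q a b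
      rw [h, mul_div_cancel_left₀ _ (mul_ne_zero (qFactorial_ne_zero a) (qFactorial_ne_zero b)), hx,
        map_mul, map_mul, map_ringBinomial, map_ringInt, map_binomialSum, hφ]
      simp only [qBinomial_eq]
      rfl
    have hy' : (-1) ^ ((a : ℤ) - (b : ℤ)) *
        QAnalog.q ^ ((a : ℤ) * (b : ℤ) - (a.choose 2 : ℤ) - (b.choose 2 : ℤ)) *
        QAnalog.qInt p = φ y := by
      rw [neg_one_zpow_sub, hy, map_mul, map_mul, map_ringInt, hφ, map_pow, map_neg, map_one]
      congr 2
      exact (val_laurentQ_zpow _).symm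
    obtain ⟨c, hc⟩ := sq_ringInt_dvd_of_prime laurentQ hp ha hb
    refine ⟨hx' ▸ x.2, hy' ▸ y.2, c, c.2, ?_⟩
    rw [hx', hy', ← map_sub, hc, map_mul, map_pow, map_ringInt, hφ]
    rfl
  · have h := sq_ringInt_dvd_of_prime (1 : ℤˣ) hp ha hb
    simp only [Units.val_one, one_zpow, ringBinomial_one, ringInt_one, binomialSum, one_pow,
      one_mul, mul_one] at h
    rw [hfac, Nat.mul_div_cancel_left _ (by positivity), units_neg_one_zpow_sub]
    refine (Int.modEq_iff_dvd.2 ?_).symm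
    exact_mod_cast h
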